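/- Let $n\ge 1$, let $h_1,\dots,h_n>0$ with $\sum_{k=1}^n h_k=1$, let $\alpha_1,\dots,\alpha_n\in[0,1]$ and let $\sigma>0$. Consider the channel $Y=\sum_{k=1}^n h_kX_k+Z$ with input $\mathbf X=(X_1,\dots,X_n)$ and noise $Z\sim\mathcal N(0,\sigma^2)$ independent of $\mathbf X$, and let $$\mathsf C_{\mathrm B}(\mathbf h,\boldsymbol\alpha,\sigma)=\sup I(\mathbf X;Y)$$ be its capacity (in nats) under the bounded-cost constraints, the supremum being over all probability laws of $\mathbf X$ with $0\le X_k\le 1$ almost surely and $\mathbb E[X_k]\le\alpha_k$ for every $k\in\{1,\dots,n\}$. For $0\le i\le n-1$ put $$\mathsf H_{[i]}=\sum_{k=1}^{i}h_k,\qquad \bar\alpha_i=\frac{\sum_{k=i+1}^{n}h_k\alpha_k}{1-\mathsf H_{[i]}}.$$ Then for all real numbers $\lambda_0,\dots,\lambda_{n-1}\ge 0$ and every $\delta>0$, with $$\mathsf P=\int_0^{1+\delta}\exp\Bigl(-\lambda_0y-\sum_{i=1}^{n-1}\lambda_i\max\{y-\mathsf H_{[i]},0\}\Bigr)\,dy,$$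 one has $$\mathsf C_{\mathrm B}(\mathbf h,\boldsymbol\alpha,\sigma)\le\log\Bigl(1+\frac{\mathsf P}{\sqrt{2\pi e}\,\sigma}\Bigr)+\sum_{i=0}^{n-1}\lambda_i\,(1-\mathsf H_{[i]})\,\bar\alpha_i+\sum_{i=0}^{n-1}\frac{\lambda_i\sigma}{\sqrt{2\pi}}\Bigl(1-e^{-\frac{(1+\delta)^2}{2\sigma^2}}\Bigr).$$ -/

import Mathlib

open MeasureTheory ProbabilityTheory
open scoped ENNReal

noncomputable section

namespace OpticalMISO

/-- Mutual information (in nats) of a pair with joint law `ρ`: the Kullback-Leibler divergence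
of the joint law from the product of its two marginals. -/
def mutualInfo {A B : Type*} [MeasurableSpace A] [MeasurableSpace B] (ρ : Measure (A × B)) : ℝ≥0∞ :=
  InformationTheory.klDiv ρ (ρ.fst.prod ρ.snd)

/-- The joint law of `(X, Y)` with `Y = ∑ k, h k * X k + Z`, where `X` has law `μ` and
`Z ∼ N(0, σ²)` is independent of `X`. -/
def jointLaw {n : ℕ} (h : Fin n → ℝ) (σ : ℝ) (μ : Measure (Fin n → ℝ)) :
    Measure ((Fin n → ℝ) × ℝ) :=
  (μ.prod (gaussianReal 0 (σ ^ 2).toNNReal)).map (fun p => (p.1, (∑ k, h k * p.1 k) + p.2))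

/-- The bounded-cost constraints on the law `μ` of the input: almost surely every entry lies in
`[0, 1]`, and the `k`-th entry has mean at most `α k`. -/
structure IsFeasibleBC {n : ℕ} (α : Fin n → ℝ) (μ : Measure (Fin n → ℝ)) : Prop where
  isProbabilityMeasure : IsProbabilityMeasure μ
  peak : ∀ᵐ x ∂μ, ∀ k, 0 ≤ x k ∧ x k ≤ 1
  mean_le : ∀ k, ∫ x, x k ∂μ ≤ α k

/-- The single-letter capacity of the channel under bounded-cost constraints: the supremum of
`I(X; Y)` over all feasible input laws. -/
def capacityBC {n : ℕ} (h α : Fin n → ℝ) (σ : ℝ) : ℝ≥0∞ :=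
  ⨆ (μ : Measure (Fin n → ℝ)) (_ : IsFeasibleBC α μ), mutualInfo (jointLaw h σ μ)

/-- The sum of the first `k` channel gains (the `i`-th gain, `1 ≤ i ≤ n`, is `h (i - 1)`). -/
def cumGain {n : ℕ} (h : Fin n → ℝ) (k : ℕ) : ℝ :=
  ∑ i : Fin n with i.val < k, h i

/-- The weighted average intensity of the last `n - k` transmitters. -/
def avgTail {n : ℕ} (h α : Fin n → ℝ) (k : ℕ) : ℝ :=
  (∑ i : Fin n with k ≤ i.val, h i * α i) / (1 - cumGain h k)

/-- The integral of `exp (-l₀ y - ∑_{1 ≤ i ≤ n-1} lᵢ (y - Hᵢ)₊)` over `0 ≤ y ≤ 1 + δ`. -/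
def dualP {n : ℕ} (h : Fin n → ℝ) (l : ℕ → ℝ) (δ : ℝ) : ℝ :=
  ∫ y in (0 : ℝ)..(1 + δ),
    Real.exp (-(l 0) * y - ∑ i ∈ Finset.Ico 1 n, l i * max (y - cumGain h i) 0)

end OpticalMISO

end

/-!
The proof is the dual (test-density) bound on mutual information. For every law `R` on the output
space, `I(X; Y)` is at most the divergence of the joint law from (law of `X`) × `R`
(`klDiv_fst_prod_snd_le`). For an `R` with density `exp (-G)` this divergence is the mean of
`G(Y)` minus the differential entropy of the noise (`klDiv_additiveGaussian_le`).

With `A = 1 + δ` and `S = ∑ k, h k * X k ∈ [0, 1]`, the test density is proportional to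
`e^{-1/2} exp (-ψ y)` on `[0, A]`, where `ψ y = ∑ i, l i * max (y - H i) 0`, and to Gaussian tails of
variance `σ²` centred at `0` and at `A` outside this interval (`testCost`). Its total mass is
`√(2π) σ + e^{-1/2} P = √(2π) σ (1 + P / (√(2πe) σ))` (`lintegral_exp_neg_testCost`), which is
where the logarithm in the bound comes from. The factor `e^{-1/2}` is chosen to match the tails:
conditionally on `Y` leaving `[0, A]` on one side, the quadratic cost has mean at most `1 / 2`
(`integral_indicator_Ioi_sq_le`), so that the tails cost no more than the constant part of the
middle piece, and the constant `1 / 2` cancels against the entropy of the noise.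

What remains is the mean of `ψ(Y)` on `Y ∈ [0, A]`. Each hinge term there exceeds its value at the
noiseless output by at most `σ² (φ 0 - φ A)`, with `φ` the noise density
(`integral_indicator_Icc_max_le`); and the mean of `max (S - H i) 0` is at most the mean contribution
of the inputs beyond the first `i`, which the constraints bound by `∑ k ≥ i, h k * α k`
(`IsFeasibleBC.integral_max_le`).
-/

namespace OpticalMISO

open InformationTheory Set Filter

/-! ### The duality bound on mutual information -/

/-- Among all product measures `ρ.fst.prod R`, the product of the marginals is closest to `ρ`: by the
chain rule, disintegrating `ρ` along its second marginal, the two divergences differ by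
`klDiv ρ.snd R`. -/
theorem klDiv_fst_prod_snd_le {A B : Type*} [MeasurableSpace A] [StandardBorelSpace A]
    [Nonempty A] [MeasurableSpace B] (ρ : Measure (A × B)) [IsProbabilityMeasure ρ]
    (R : Measure B) [IsProbabilityMeasure R] :
    klDiv ρ (ρ.fst.prod ρ.snd) ≤ klDiv ρ (ρ.fst.prod R) := by
  have hswap : (ρ.map Prod.swap).map Prod.swap = ρ := by
    rw [Measure.map_map measurable_swap measurable_swap]
    simp
  have hρ : IsProbabilityMeasure (ρ.map Prod.swap) :=
    Measure.isProbabilityMeasure_map measurable_swap.aemeasurable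
  have hdis : ρ.map Prod.swap = ρ.snd ⊗ₘ (ρ.map Prod.swap).condKernel := by
    conv_lhs => rw [← (ρ.map Prod.swap).disintegrate (ρ.map Prod.swap).condKernel]
    rw [Measure.fst_map_swap]
  calc klDiv ρ (ρ.fst.prod ρ.snd)
      = klDiv ((ρ.map Prod.swap).map Prod.swap) ((ρ.snd.prod ρ.fst).map Prod.swap) := by
        rw [hswap, Measure.prod_swap]
    _ ≤ klDiv (ρ.map Prod.swap) (ρ.snd.prod ρ.fst) := klDiv_map_le _ _ measurable_swap
    _ ≤ klDiv ρ.snd R + klDiv (ρ.map Prod.swap) (ρ.snd.prod ρ.fst) := le_add_self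
    _ = klDiv (ρ.map Prod.swap) (R.prod ρ.fst) := by
        rw [← Measure.compProd_const, ← Measure.compProd_const, hdis, ← klDiv_compProd_eq_add]
    _ = klDiv (ρ.map Prod.swap) ((ρ.fst.prod R).map Prod.swap) := by rw [Measure.prod_swap]
    _ ≤ klDiv ρ (ρ.fst.prod R) := klDiv_map_le _ _ measurable_swap

/-- For the additive channel `y = s x + z` with Gaussian noise, the divergence from the product of the
input law and the test law with density `exp (-G)` is at most the mean of `G` at the output minus
the differential entropy `log √(2πv) + 1 / 2` of the noise. -/
theorem klDiv_additiveGaussian_le {A : Type*} [MeasurableSpace A] (μ : Measure A)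
    [IsProbabilityMeasure μ] {s : A → ℝ} (hs : Measurable s) {v : NNReal} (hv : v ≠ 0)
    {G : ℝ → ℝ} (hG : Measurable G) (hG1 : ∫⁻ y, ENNReal.ofReal (Real.exp (-G y)) = 1)
    (hint : Integrable (fun p : A × ℝ => G (s p.1 + p.2)) (μ.prod (gaussianReal 0 v))) :
    klDiv ((μ.prod (gaussianReal 0 v)).map (fun p => (p.1, s p.1 + p.2)))
        (μ.prod (volume.withDensity fun y => ENNReal.ofReal (Real.exp (-G y)))) ≤
      ENNReal.ofReal (∫ p, G (s p.1 + p.2) ∂(μ.prod (gaussianReal 0 v))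
        - (Real.log (√(2 * Real.pi * v)) + 1 / 2)) := by
  set N := gaussianReal 0 v with hN
  set R := volume.withDensity fun y => ENNReal.ofReal (Real.exp (-G y)) with hR
  set T : A × ℝ → A × ℝ := fun p => (p.1, s p.1 + p.2) with hT
  have hTm : Measurable T := by fun_prop
  have hRp : IsProbabilityMeasure R := ⟨by rw [hR, withDensity_apply _ .univ]; simpa using hG1⟩
  have hv' : (0 : ℝ) < v := by positivity
  have hρ : IsProbabilityMeasure ((μ.prod N).map T) :=
    Measure.isProbabilityMeasure_map hTm.aemeasurable
  set g : A × ℝ → ℝ := fun p => gaussianPDFReal 0 v (p.2 - s p.1) * Real.exp (G p.2) with hg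
  have hgm : Measurable g := by fun_prop
  -- `g` is the density of the joint law with respect to `μ.prod R`, hence the factor `exp G`
  -- that cancels the density of `R`.
  have hdens : (μ.prod N).map T = (μ.prod R).withDensity fun p => ENNReal.ofReal (g p) := by
    refine Measure.ext_of_lintegral _ fun f hf => ?_
    rw [lintegral_map hf hTm, lintegral_withDensity_eq_lintegral_mul _ (by fun_prop) hf,
      lintegral_prod _ (by fun_prop), lintegral_prod _ (by fun_prop)]
    congr 1 with x
    rw [hN, gaussianReal_of_var_ne_zero _ hv, hR,
      lintegral_withDensity_eq_lintegral_mul _ (by fun_prop) (by fun_prop),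
      lintegral_withDensity_eq_lintegral_mul _ (by fun_prop) (by fun_prop)]
    conv_rhs => rw [← lintegral_add_left_eq_self _ (s x)]
    congr 1 with z
    simp only [Pi.mul_apply, hT, hg, gaussianPDF]
    rw [← mul_assoc, ← ENNReal.ofReal_mul (by positivity)]
    congr 2
    rw [mul_comm, mul_assoc, ← Real.exp_add]
    simp
  have hac : (μ.prod N).map T ≪ μ.prod R := by
    rw [hdens]; exact withDensity_absolutelyContinuous _ _
  have hllr : (fun p => llr ((μ.prod N).map T) (μ.prod R) (T p)) =ᵐ[μ.prod N]
      fun p => G (s p.1 + p.2) - (Real.log (√(2 * Real.pi * v)) + p.2 ^ 2 / (2 * v)) := by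
    have h1 : ((μ.prod N).map T).rnDeriv (μ.prod R) =ᵐ[μ.prod R]
        fun p => ENNReal.ofReal (g p) := by
      rw [hdens]; exact Measure.rnDeriv_withDensity _ (by fun_prop)
    filter_upwards [ae_of_ae_map hTm.aemeasurable (hac.ae_le h1)] with p hp
    have h2 : 0 < √(2 * Real.pi * v) := by positivity
    rw [llr, hp, ENNReal.toReal_ofReal
      (mul_nonneg (gaussianPDFReal_nonneg _ _ _) (Real.exp_nonneg _))]
    simp only [hT, gaussianPDFReal]
    rw [Real.log_mul (by positivity) (by positivity), Real.log_mul (by positivity) (by positivity),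
      Real.log_exp, Real.log_exp, Real.log_inv]
    ring_nf
  have hsq : Integrable (fun z : ℝ => z ^ 2) N :=
    (memLp_id_gaussianReal (μ := 0) (v := v) 2).integrable_sq
  have hsq' : Integrable (fun p : A × ℝ =>
      Real.log (√(2 * Real.pi * v)) + p.2 ^ 2 / (2 * v)) (μ.prod N) :=
    (integrable_const _).add ((hsq.div_const _).comp_snd μ)
  have hvar : ∫ z, z ^ 2 ∂N = v := by
    have := variance_fun_id_gaussianReal (μ := 0) (v := v)
    rwa [variance_of_integral_eq_zero (by fun_prop) (by simp)] at this
  have hllr_int : Integrable (llr ((μ.prod N).map T) (μ.prod R)) ((μ.prod N).map T) := by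
    rw [integrable_map_measure (by fun_prop) hTm.aemeasurable]
    exact (integrable_congr hllr).mpr (hint.sub hsq')
  refine (klDiv_of_ac_of_integrable hac hllr_int).trans_le (ENNReal.ofReal_le_ofReal (le_of_eq ?_))
  rw [integral_map hTm.aemeasurable (by fun_prop), integral_congr_ae hllr,
    integral_sub hint hsq', integral_add (integrable_const _) ((hsq.div_const _).comp_snd μ),
    integral_fun_snd (f := fun z : ℝ => z ^ 2 / (2 * (v : ℝ))), integral_div, hvar]
  simp
  field_simp

/-! ### Truncated Gaussian moments -/

theorem hasDerivAt_gaussianPDFReal (v : NNReal) (z : ℝ) :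
    HasDerivAt (gaussianPDFReal 0 v) (gaussianPDFReal 0 v z * (-z / v)) z := by
  have h : HasDerivAt (fun z : ℝ => -(z - 0) ^ 2 / (2 * (v : ℝ))) (-z / v) z := by
    refine ((((hasDerivAt_id' z).sub_const 0).fun_pow 2).fun_neg.div_const
      (2 * (v : ℝ))).congr_deriv ?_
    rw [neg_div, neg_div, Nat.cast_ofNat, mul_assoc, mul_div_mul_left _ _ two_ne_zero]
    simp
  rw [gaussianPDFReal_def]
  refine (h.exp.const_mul ((√(2 * Real.pi * v))⁻¹)).congr_deriv ?_
  ring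

theorem gaussianPDFReal_zero_le_of_abs_le (v : NNReal) {a b : ℝ} (hab : |a| ≤ |b|) :
    gaussianPDFReal 0 v b ≤ gaussianPDFReal 0 v a := by
  simp only [gaussianPDFReal, sub_zero]
  have := sq_le_sq.mpr hab
  gcongr

theorem integrable_sq_gaussianReal (v : NNReal) :
    Integrable (fun z : ℝ => z ^ 2) (gaussianReal 0 v) :=
  (memLp_id_gaussianReal (μ := 0) (v := v) 2).integrable_sq

theorem integrable_id_gaussianReal (v : NNReal) :
    Integrable (fun z : ℝ => z) (gaussianReal 0 v) :=
  (memLp_id_gaussianReal (μ := 0) (v := v) 1).integrable le_rfl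

theorem integrable_gaussianPDFReal_mul {v : NNReal} (hv : v ≠ 0) {f : ℝ → ℝ}
    (hf : Integrable f (gaussianReal 0 v)) :
    Integrable (fun z => gaussianPDFReal 0 v z * f z) := by
  rw [gaussianReal_of_var_ne_zero _ hv, integrable_withDensity_iff_integrable_smul'
    (measurable_gaussianPDF _ _) (by simp [gaussianPDF_lt_top])] at hf
  simpa using hf

theorem integral_indicator_gaussianReal {v : NNReal} (hv : v ≠ 0) {s : Set ℝ}
    (hs : MeasurableSet s) (f : ℝ → ℝ) :
    ∫ z, s.indicator f z ∂(gaussianReal 0 v) = ∫ z in s, gaussianPDFReal 0 v z * f z := by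
  rw [integral_gaussianReal_eq_integral_smul hv, ← integral_indicator hs]
  congr 1 with z
  by_cases hz : z ∈ s <;> simp [hz]

/-- For `t ≥ 0` the second moment of the excess of a centred Gaussian over `t`, conditional on the
excess being positive, is at most the variance. -/
theorem integral_indicator_Ioi_sq_le {v : NNReal} (hv : v ≠ 0) {t : ℝ} (ht : 0 ≤ t) :
    ∫ z, (Ioi t).indicator (fun z => (z - t) ^ 2 / (2 * v) - 1 / 2) z ∂(gaussianReal 0 v) ≤ 0 := by
  have hv' : (0 : ℝ) < v := by positivity
  have hid := integrable_id_gaussianReal v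
  have hsq := integrable_sq_gaussianReal v
  set φ := gaussianPDFReal 0 v with hφ
  have hint : Integrable (fun z => φ z * ((z ^ 2 - t * z) / (2 * v) - 1 / 2)) :=
    integrable_gaussianPDFReal_mul hv
      (((hsq.sub (hid.const_mul t)).div_const _).sub (integrable_const _))
  have hint' : Integrable (fun z => φ z * ((z - t) ^ 2 / (2 * v) - 1 / 2)) := by
    refine integrable_gaussianPDFReal_mul hv (Integrable.sub (Integrable.div_const ?_ _)
      (integrable_const _))
    have : (fun z : ℝ => (z - t) ^ 2) = fun z => z ^ 2 - 2 * t * z + t ^ 2 := by ext; ring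
    rw [this]
    exact (hsq.sub (hid.const_mul (2 * t))).add (integrable_const _)
  have hF : Integrable (fun z => φ z * ((t - z) / 2)) :=
    integrable_gaussianPDFReal_mul hv (((integrable_const t).sub hid).div_const 2)
  have hderiv (z : ℝ) : HasDerivAt (fun z => φ z * ((t - z) / 2))
      (φ z * ((z ^ 2 - t * z) / (2 * v) - 1 / 2)) z := by
    refine ((hasDerivAt_gaussianPDFReal v z).fun_mul
      (((hasDerivAt_id' z).const_sub t).div_const 2)).congr_deriv ?_
    rw [← hφ]
    field_simp
    ring
  have hlim := tendsto_zero_of_hasDerivAt_of_integrableOn_Ioi (a := t) (fun z _ => hderiv z)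
    hint.integrableOn hF.integrableOn
  -- On `z > t ≥ 0`, `(z - t) ^ 2 ≤ z ^ 2 - t * z`, and with the larger quadratic the integrand
  -- has the explicit primitive `φ z * ((t - z) / 2)`, which vanishes at `t` and at infinity.
  rw [integral_indicator_gaussianReal hv measurableSet_Ioi]
  calc ∫ z in Ioi t, φ z * ((z - t) ^ 2 / (2 * v) - 1 / 2)
      ≤ ∫ z in Ioi t, φ z * ((z ^ 2 - t * z) / (2 * v) - 1 / 2) := by
        refine setIntegral_mono_on hint'.integrableOn hint.integrableOn measurableSet_Ioi
          fun z hz => ?_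
        have hz' : t < z := hz
        have := gaussianPDFReal_nonneg 0 v z
        gcongr
        nlinarith
    _ = 0 := by
        rw [integral_Ioi_of_hasDerivAt_of_tendsto' (fun z _ => hderiv z) hint.integrableOn hlim]
        simp

theorem integral_indicator_Iio_sq_le {v : NNReal} (hv : v ≠ 0) {t : ℝ} (ht : 0 ≤ t) :
    ∫ z, (Iio (-t)).indicator (fun z => (z + t) ^ 2 / (2 * v) - 1 / 2) z ∂(gaussianReal 0 v)
      ≤ 0 := by
  have hmap : (gaussianReal 0 v).map (fun z => -z) = gaussianReal 0 v := by
    simpa using gaussianReal_map_neg (μ := 0) (v := v)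
  rw [← hmap, integral_map (by fun_prop)
    ((by fun_prop : Measurable _).indicator measurableSet_Iio).aestronglyMeasurable]
  refine (integral_indicator_Ioi_sq_le hv ht).trans_eq' (integral_congr_ae (.of_forall fun z => ?_))
  by_cases hz : t < z
  · simp [hz]; ring
  · simp [hz]

/-- Truncated to outputs in `[0, A]`, the mean of the hinge `max (s + Z - H) 0` exceeds
`max (s - H) 0` by at most `v (φ 0 - φ A)`, where `φ` is the density of `Z`. -/
theorem integral_indicator_Icc_max_le {v : NNReal} (hv : v ≠ 0) {A H s : ℝ} (hs : 0 ≤ s)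
    (hsA : s ≤ A) (hH0 : 0 ≤ H) (hH : H ≤ A) :
    ∫ z, (Icc 0 A).indicator (fun y => max (y - H) 0) (s + z) ∂(gaussianReal 0 v) ≤
      max (s - H) 0 + v * (gaussianPDFReal 0 v 0 - gaussianPDFReal 0 v A) := by
  have hv' : (0 : ℝ) < v := by positivity
  have hid := integrable_id_gaussianReal v
  set φ := gaussianPDFReal 0 v with hφ
  have hint : Integrable ((Icc (H - s) (A - s)).indicator fun z => z) (gaussianReal 0 v) :=
    hid.indicator measurableSet_Icc
  -- On the event that the hinge is active, `z` lies in `[H - s, A - s]` and the hinge equals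
  -- `(s - H) + z`; the primitive of `φ z * z` is `-v φ`.
  calc ∫ z, (Icc 0 A).indicator (fun y => max (y - H) 0) (s + z) ∂(gaussianReal 0 v)
      ≤ ∫ z, (max (s - H) 0 + (Icc (H - s) (A - s)).indicator (fun z => z) z)
          ∂(gaussianReal 0 v) := by
        refine integral_mono_of_nonneg (.of_forall fun z => ?_)
          ((integrable_const _).add hint) (.of_forall fun z => ?_)
        · exact indicator_nonneg (fun y _ => le_max_right _ _) _
        · have h0 := le_max_right (s - H) 0
          have h1 := le_max_left (s - H) 0
          simp only [indicator_apply, mem_Icc]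
          split_ifs with h2 h3 h3
          · exact max_le (by linarith) (by linarith)
          · rw [max_eq_right]
            · linarith
            · by_contra! h4
              exact h3 ⟨by linarith, by linarith⟩
          · exact absurd ⟨by linarith, by linarith⟩ h2
          · linarith
    _ = max (s - H) 0 + ∫ z in Icc (H - s) (A - s), φ z * z := by
        rw [integral_add (integrable_const _) hint,
          integral_indicator_gaussianReal hv measurableSet_Icc]
        simp [hφ]
    _ = max (s - H) 0 + (v * φ (H - s) - v * φ (A - s)) := by
        rw [integral_Icc_eq_integral_Ioc, ← intervalIntegral.integral_of_le (by linarith),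
          intervalIntegral.integral_eq_sub_of_hasDerivAt (f := fun z => -(v * φ z))]
        · ring
        · intro z _
          refine ((hasDerivAt_gaussianPDFReal v z).const_mul (v : ℝ)).fun_neg.congr_deriv ?_
          rw [← hφ]
          field_simp
        · exact (integrable_gaussianPDFReal_mul hv hid).intervalIntegrable
    _ ≤ max (s - H) 0 + v * (φ 0 - φ A) := by
        have h1 : φ (H - s) ≤ φ 0 := gaussianPDFReal_zero_le_of_abs_le v (by simp)
        have h2 : φ A ≤ φ (A - s) := gaussianPDFReal_zero_le_of_abs_le v (by
          rw [abs_of_nonneg (by linarith), abs_of_nonneg (by linarith)]; linarith)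
        nlinarith

/-! ### The test density -/

/-- Minus the logarithm of the test density on the output space: up to the constant `K` it is
`1 / 2 + ψ y` on `[0, A]` and a Gaussian exponent `d ^ 2 / (2 * v)` at distance `d` outside `[0, A]`.
The constant `1 / 2` is pulled out of all three pieces, so that the outer ones become
`d ^ 2 / (2 * v) - 1 / 2`, whose Gaussian tail integrals are nonpositive. -/
noncomputable def testCost (v : NNReal) (A K : ℝ) (ψ : ℝ → ℝ) (y : ℝ) : ℝ :=
  K + 1 / 2 + ((Iio 0).indicator (fun y : ℝ => y ^ 2 / (2 * (v : ℝ)) - 1 / 2) y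
    + (Icc 0 A).indicator ψ y
    + (Ioi A).indicator (fun y : ℝ => (y - A) ^ 2 / (2 * (v : ℝ)) - 1 / 2) y)

theorem measurable_testCost (v : NNReal) (A K : ℝ) {ψ : ℝ → ℝ} (hψ : Measurable ψ) :
    Measurable (testCost v A K ψ) := by
  have h₁ : Measurable ((Iio 0).indicator fun y : ℝ => y ^ 2 / (2 * (v : ℝ)) - 1 / 2) :=
    Measurable.indicator (by fun_prop) measurableSet_Iio
  have h₂ : Measurable ((Icc 0 A).indicator ψ) := hψ.indicator measurableSet_Icc
  have h₃ : Measurable ((Ioi A).indicator fun y : ℝ => (y - A) ^ 2 / (2 * (v : ℝ)) - 1 / 2) :=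
    Measurable.indicator (by fun_prop) measurableSet_Ioi
  exact measurable_const.add ((h₁.add h₂).add h₃)

theorem integral_Ioi_exp_neg_sq_div {v : NNReal} (hv : v ≠ 0) :
    Integrable (fun y : ℝ => Real.exp (-(y ^ 2 / (2 * v)))) ∧
      ∫ y in Ioi (0 : ℝ), Real.exp (-(y ^ 2 / (2 * v))) = √(2 * Real.pi * v) / 2 := by
  have hv' : (0 : ℝ) < v := by positivity
  have h : (fun y : ℝ => Real.exp (-(y ^ 2 / (2 * v)))) =
      fun y => Real.exp (-(1 / (2 * (v : ℝ))) * y ^ 2) := by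
    ext y; ring_nf
  rw [h, integral_gaussian_Ioi]
  refine ⟨integrable_exp_neg_mul_sq (by positivity), ?_⟩
  congr 2
  field_simp

/-- The constant `K` that makes `exp (-testCost)` a probability density: the two outer pieces have
total mass `√(2πv)` and the middle one has mass `e^{-1/2} ∫ exp (-ψ)`, each times `e^{-K}`. -/
theorem lintegral_exp_neg_testCost {v : NNReal} (hv : v ≠ 0) {A : ℝ} (hA : 0 ≤ A)
    {ψ : ℝ → ℝ} (hψ : Continuous ψ) :
    ∫⁻ y, ENNReal.ofReal (Real.exp (-testCost v A
      (Real.log (√(2 * Real.pi * v) + Real.exp (-(1 / 2)) * ∫ y in (0 : ℝ)..A, Real.exp (-ψ y)))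
      ψ y)) = 1 := by
  have hv' : (0 : ℝ) < v := by positivity
  obtain ⟨hgi, hg⟩ := integral_Ioi_exp_neg_sq_div hv
  set q : ℝ → ℝ := fun y => Real.exp (-(y ^ 2 / (2 * v))) with hq
  set P := ∫ y in (0 : ℝ)..A, Real.exp (-ψ y) with hP
  have hP0 : 0 ≤ P := intervalIntegral.integral_nonneg hA fun y _ => (Real.exp_pos _).le
  set M := √(2 * Real.pi * v) + Real.exp (-(1 / 2)) * P with hM
  have hM0 : 0 < M := by positivity
  have hexp (y : ℝ) : Real.exp (-testCost v A (Real.log M) ψ y) =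
      M⁻¹ * ((Iio 0).indicator q y
        + (Icc 0 A).indicator (fun y => Real.exp (-(1 / 2)) * Real.exp (-ψ y)) y
        + (Ioi A).indicator (fun y => q (y - A)) y) := by
    have hK : M⁻¹ = Real.exp (-Real.log M) := by rw [Real.exp_neg, Real.exp_log hM0]
    rw [hK, testCost]
    rcases lt_or_ge y 0 with h1 | h1
    · have h2 : ¬ A < y := by linarith
      simp only [hq, indicator_apply, mem_Iio, mem_Icc, mem_Ioi, h1, h2, not_le.mpr h1, if_true,
        if_false, false_and, add_zero]
      rw [← Real.exp_add]
      congr 1; ring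
    · rcases le_or_gt y A with h2 | h2
      · simp only [hq, indicator_apply, mem_Iio, mem_Icc, mem_Ioi, h1, h2, not_lt.mpr h1,
          not_lt.mpr h2, if_true, if_false, and_self, add_zero, zero_add]
        rw [← Real.exp_add, ← Real.exp_add]
        congr 1; ring
      · simp only [hq, indicator_apply, mem_Iio, mem_Icc, mem_Ioi, h2, not_lt.mpr h1,
          not_le.mpr h2, if_true, if_false, and_false, zero_add]
        rw [← Real.exp_add]
        congr 1; ring
  have i1 : IntegrableOn q (Iio 0) := hgi.integrableOn
  have v1 : ∫ y in Iio 0, q y = √(2 * Real.pi * v) / 2 := by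
    have := integral_comp_neg_Ioi 0 q
    rw [neg_zero, integral_Iic_eq_integral_Iio] at this
    rw [← this, ← hg]
    simp [hq]
  have i2 : IntegrableOn (fun y => Real.exp (-(1 / 2)) * Real.exp (-ψ y)) (Icc 0 A) :=
    Continuous.integrableOn_Icc (by fun_prop)
  have v2 : ∫ y in Icc 0 A, Real.exp (-(1 / 2)) * Real.exp (-ψ y) = Real.exp (-(1 / 2)) * P := by
    rw [integral_const_mul, hP, intervalIntegral.integral_of_le hA, integral_Icc_eq_integral_Ioc]
  have i3 : IntegrableOn (fun y => q (y - A)) (Ioi A) := (hgi.comp_sub_right A).integrableOn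
  have v3 : ∫ y in Ioi A, q (y - A) = √(2 * Real.pi * v) / 2 := by
    rw [← hg, ← integral_indicator measurableSet_Ioi, ← integral_indicator measurableSet_Ioi,
      ← integral_sub_right_eq_self ((Ioi 0).indicator q) A]
    congr 1 with y
    simp [indicator_apply]
  have I1 := i1.integrable_indicator measurableSet_Iio
  have I2 := i2.integrable_indicator measurableSet_Icc
  have I3 := i3.integrable_indicator measurableSet_Ioi
  have I12 : Integrable fun y => (Iio 0).indicator q y
      + (Icc 0 A).indicator (fun y => Real.exp (-(1 / 2)) * Real.exp (-ψ y)) y := I1.add I2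
  have I123 : Integrable fun y => M⁻¹ * ((Iio 0).indicator q y
      + (Icc 0 A).indicator (fun y => Real.exp (-(1 / 2)) * Real.exp (-ψ y)) y
      + (Ioi A).indicator (fun y => q (y - A)) y) := (I12.add I3).const_mul _
  simp_rw [hexp]
  rw [← ofReal_integral_eq_lintegral_ofReal I123
    (.of_forall fun y => (Real.exp_pos _).le.trans_eq (hexp y)), integral_const_mul,
    integral_add I12 I3, integral_add I1 I2, integral_indicator measurableSet_Iio,
    integral_indicator measurableSet_Icc, integral_indicator measurableSet_Ioi, v1, v2, v3,
    ← ENNReal.ofReal_one]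
  congr 1
  rw [hM]
  field_simp
  ring

/-- The cost of the output grows at most quadratically in the noise, uniformly in the signal. -/
theorem integrable_testCost_add {X : Type*} [MeasurableSpace X] {μ : Measure X}
    [IsProbabilityMeasure μ] {v : NNReal} (A K : ℝ) {s : X → ℝ} (hs : Measurable s)
    (hs0 : ∀ᵐ x ∂μ, 0 ≤ s x ∧ s x ≤ A) {ψ : ℝ → ℝ} (hψ : Continuous ψ) :
    Integrable (fun p : X × ℝ => testCost v A K ψ (s p.1 + p.2)) (μ.prod (gaussianReal 0 v)) := by
  obtain ⟨C, hC⟩ := isCompact_Icc.exists_bound_of_continuousOn (s := Icc 0 A) hψ.continuousOn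
  have hsq := ((integrable_sq_gaussianReal v).comp_snd μ).div_const (v : ℝ)
  have hdom : Integrable (fun p : X × ℝ => |K + 1 / 2| + (1 + 2 * A ^ 2 / v + |C|
      + 2 * (p.2 ^ 2 / v))) (μ.prod (gaussianReal 0 v)) :=
    (integrable_const _).add ((integrable_const _).add (hsq.const_mul 2))
  refine hdom.mono' ?_ ?_
  · exact ((measurable_testCost v A K hψ.measurable).comp (by fun_prop)).aestronglyMeasurable
  · have hs' : ∀ᵐ p ∂(μ.prod (gaussianReal 0 v)), 0 ≤ s p.1 ∧ s p.1 ≤ A :=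
      Measure.quasiMeasurePreserving_fst.ae hs0
    filter_upwards [hs'] with p hp
    have hb (w : ℝ) (hw : w ^ 2 ≤ 2 * A ^ 2 + 2 * p.2 ^ 2) :
        |w ^ 2 / (2 * v) - 1 / 2| ≤ 1 + 2 * A ^ 2 / v + |C| + 2 * (p.2 ^ 2 / v) := by
      have h1 : w ^ 2 / (2 * v) ≤ (A ^ 2 + p.2 ^ 2) / v := by
        rw [mul_comm, ← div_div, div_right_comm]
        gcongr
        linarith
      have h2 : 0 ≤ w ^ 2 / (2 * v) := by positivity
      have h3 : 0 ≤ A ^ 2 / v := by positivity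
      have h4 : 0 ≤ p.2 ^ 2 / v := by positivity
      rw [add_div] at h1
      rw [abs_le]
      constructor <;> rw [mul_div_assoc] <;> linarith [abs_nonneg C]
    rw [Real.norm_eq_abs, testCost]
    refine (abs_add_le _ _).trans (add_le_add le_rfl ?_)
    rcases lt_or_ge (s p.1 + p.2) 0 with h1 | h1
    · have h2 : ¬ A < s p.1 + p.2 := by linarith
      simp only [indicator_apply, mem_Iio, mem_Icc, mem_Ioi, h1, h2, not_le.mpr h1, if_true,
        if_false, false_and, add_zero]
      apply hb
      nlinarith [sq_nonneg (s p.1 - p.2)]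
    · rcases le_or_gt (s p.1 + p.2) A with h2 | h2
      · simp only [indicator_apply, mem_Iio, mem_Icc, mem_Ioi, h1, h2, not_lt.mpr h1,
          not_lt.mpr h2, if_true, if_false, and_self, add_zero, zero_add]
        have h3 := (hC _ ⟨h1, h2⟩).trans (le_abs_self C)
        have : 0 ≤ 1 + 2 * A ^ 2 / v + 2 * (p.2 ^ 2 / v) := by positivity
        rw [Real.norm_eq_abs] at h3
        linarith
      · simp only [indicator_apply, mem_Iio, mem_Icc, mem_Ioi, h2, not_lt.mpr h1,
          not_le.mpr h2, if_true, if_false, and_false, zero_add]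
        apply hb
        nlinarith [sq_nonneg (s p.1 - A - p.2)]

/-- The expected cost of the output `s + Z` for a fixed signal `s ∈ [0, A]`: the two tails contribute
nothing beyond the constant, and every hinge term contributes its value at `s` plus a correction. -/
theorem integral_testCost_add_le {v : NNReal} (hv : v ≠ 0) {A K s : ℝ} (hs : 0 ≤ s)
    (hsA : s ≤ A) {ι : Type*} (I : Finset ι) {l H : ι → ℝ} (hl : ∀ i ∈ I, 0 ≤ l i)
    (hH : ∀ i ∈ I, 0 ≤ H i ∧ H i ≤ A) :
    ∫ z, testCost v A K (fun y => ∑ i ∈ I, l i * max (y - H i) 0) (s + z) ∂(gaussianReal 0 v) ≤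
      K + 1 / 2 + ∑ i ∈ I, l i * (max (s - H i) 0
        + v * (gaussianPDFReal 0 v 0 - gaussianPDFReal 0 v A)) := by
  set N := gaussianReal 0 v with hN
  have hid := integrable_id_gaussianReal v
  have hsq := integrable_sq_gaussianReal v
  have hquad (t : ℝ) : Integrable (fun z => (z + t) ^ 2 / (2 * v) - 1 / 2) N := by
    refine Integrable.sub (Integrable.div_const ?_ _) (integrable_const _)
    have : (fun z : ℝ => (z + t) ^ 2) = fun z => z ^ 2 + 2 * t * z + t ^ 2 := by ext; ring
    rw [this]
    exact (hsq.add (hid.const_mul (2 * t))).add (integrable_const _)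
  set f₁ := (Iio (-s)).indicator fun z : ℝ => (z + s) ^ 2 / (2 * v) - 1 / 2
  set f₂ : ι → ℝ → ℝ := fun i z => (Icc 0 A).indicator (fun y => max (y - H i) 0) (s + z)
  set f₃ := (Ioi (A - s)).indicator fun z : ℝ => (z - (A - s)) ^ 2 / (2 * v) - 1 / 2
  have e (z : ℝ) : testCost v A K (fun y => ∑ i ∈ I, l i * max (y - H i) 0) (s + z)
      = K + 1 / 2 + (f₁ z + ∑ i ∈ I, l i * f₂ i z + f₃ z) := by
    have h₁ : (s + z < 0) = (z < -s) := by rw [eq_iff_iff]; constructor <;> intro <;> linarith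
    have h₃ : (A < s + z) = (A - s < z) := by rw [eq_iff_iff]; constructor <;> intro <;> linarith
    have h₄ : z - (A - s) = s + z - A := by ring
    simp only [testCost, f₁, f₂, f₃, indicator_apply, mem_Iio, mem_Ioi, h₁, h₃, h₄, add_comm z s]
    by_cases h : s + z ∈ Icc 0 A <;> simp [h]
  have i₁ : Integrable f₁ N := (hquad s).indicator measurableSet_Iio
  have i₂ (i : ι) : Integrable (f₂ i) N := by
    refine ((integrable_const s).add hid).norm.add (integrable_const |H i|) |>.mono'
      (((by fun_prop : Measurable fun y => max (y - H i) 0).indicator measurableSet_Icc).comp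
        (by fun_prop)).aestronglyMeasurable (.of_forall fun z => ?_)
    refine (norm_indicator_le_norm_self _ _).trans ?_
    simp only [Real.norm_eq_abs, Pi.add_apply]
    rw [abs_of_nonneg (le_max_right _ _)]
    exact max_le (by linarith [le_abs_self (s + z), neg_abs_le (H i)]) (by positivity)
  have i₃ : Integrable f₃ N := by
    have := (hquad (-(A - s))).indicator (measurableSet_Ioi (a := A - s))
    simpa only [← sub_eq_add_neg] using this
  have hsum : Integrable (fun z => ∑ i ∈ I, l i * f₂ i z) N :=
    integrable_finsetSum _ fun i _ => (i₂ i).const_mul _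
  simp_rw [e]
  have i₁₂ : Integrable (fun z => f₁ z + ∑ i ∈ I, l i * f₂ i z) N := i₁.add hsum
  have i₁₂₃ : Integrable (fun z => f₁ z + ∑ i ∈ I, l i * f₂ i z + f₃ z) N := i₁₂.add i₃
  rw [integral_add (integrable_const _) i₁₂₃, integral_add i₁₂ i₃, integral_add i₁ hsum,
    integral_finsetSum _ fun i _ => (i₂ i).const_mul _]
  simp_rw [integral_const_mul]
  have b₁ : ∫ z, f₁ z ∂N ≤ 0 := integral_indicator_Iio_sq_le hv hs
  have b₃ : ∫ z, f₃ z ∂N ≤ 0 := integral_indicator_Ioi_sq_le hv (by linarith)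
  have b₂ : ∑ i ∈ I, l i * ∫ z, f₂ i z ∂N ≤ ∑ i ∈ I, l i * (max (s - H i) 0
        + v * (gaussianPDFReal 0 v 0 - gaussianPDFReal 0 v A)) :=
    Finset.sum_le_sum fun i hi => mul_le_mul_of_nonneg_left
      (integral_indicator_Icc_max_le hv hs hsA (hH i hi).1 (hH i hi).2) (hl i hi)
  simp only [integral_const, probReal_univ, one_smul]
  linarith

/-! ### Channel gains and the mean constraints -/

section Gains

variable {n : ℕ} {h : Fin n → ℝ}

theorem one_sub_cumGain (h_sum : ∑ k, h k = 1) (i : ℕ) :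
    1 - cumGain h i = ∑ k : Fin n with i ≤ k.val, h k := by
  rw [← h_sum, cumGain, sub_eq_iff_eq_add', ← Finset.sum_filter_add_sum_filter_not _ (·.val < i)]
  simp

theorem cumGain_nonneg (h_pos : ∀ k, 0 < h k) (i : ℕ) : 0 ≤ cumGain h i :=
  Finset.sum_nonneg fun k _ => (h_pos k).le

theorem cumGain_lt_one (h_pos : ∀ k, 0 < h k) (h_sum : ∑ k, h k = 1) {i : ℕ} (hi : i < n) :
    cumGain h i < 1 := by
  rw [← sub_pos, one_sub_cumGain h_sum]
  exact Finset.sum_pos (fun k _ => h_pos k) ⟨⟨i, hi⟩, by simp⟩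

/-- The hinge at `cumGain h i` of the total intensity is controlled by the inputs `k ≥ i` alone,
because the inputs `k < i` contribute at most `cumGain h i`. -/
theorem max_sub_cumGain_le (h_pos : ∀ k, 0 < h k) {x : Fin n → ℝ}
    (hx : ∀ k, 0 ≤ x k ∧ x k ≤ 1) (i : ℕ) :
    max (∑ k, h k * x k - cumGain h i) 0 ≤ ∑ k : Fin n with i ≤ k.val, h k * x k := by
  refine max_le ?_ (Finset.sum_nonneg fun k _ => mul_nonneg (h_pos k).le (hx k).1)
  rw [← Finset.sum_filter_add_sum_filter_not _ (·.val < i), cumGain]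
  have : ∑ k : Fin n with k.val < i, h k * x k ≤ ∑ k : Fin n with k.val < i, h k :=
    Finset.sum_le_sum fun k _ => mul_le_of_le_one_right (h_pos k).le (hx k).2
  simp only [not_lt]
  linarith

theorem IsFeasibleBC.integrable_apply {α : Fin n → ℝ} {μ : Measure (Fin n → ℝ)}
    (hμ : IsFeasibleBC α μ) (k : Fin n) : Integrable (fun x => x k) μ := by
  have := hμ.isProbabilityMeasure
  refine (integrable_const (1 : ℝ)).mono' (measurable_pi_apply k).aestronglyMeasurable ?_
  filter_upwards [hμ.peak] with x hx
  rw [Real.norm_eq_abs, abs_of_nonneg (hx k).1]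
  exact (hx k).2

theorem IsFeasibleBC.integrable_max {α : Fin n → ℝ} {μ : Measure (Fin n → ℝ)}
    (hμ : IsFeasibleBC α μ) (c : ℝ) :
    Integrable (fun x => max (∑ k, h k * x k - c) 0) μ := by
  have := hμ.isProbabilityMeasure
  exact ((integrable_finsetSum _ fun k _ => (hμ.integrable_apply k).const_mul (h k)).sub
    (integrable_const c)).pos_part

theorem IsFeasibleBC.integral_max_le {α : Fin n → ℝ} {μ : Measure (Fin n → ℝ)}
    (hμ : IsFeasibleBC α μ) (h_pos : ∀ k, 0 < h k) (h_sum : ∑ k, h k = 1) {i : ℕ} (hi : i < n) :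
    ∫ x, max (∑ k, h k * x k - cumGain h i) 0 ∂μ ≤ (1 - cumGain h i) * avgTail h α i := by
  have hlt := cumGain_lt_one h_pos h_sum hi
  have hint (k : Fin n) : Integrable (fun x => h k * x k) μ :=
    (hμ.integrable_apply k).const_mul (h k)
  rw [avgTail, mul_div_cancel₀ _ (by linarith)]
  calc ∫ x, max (∑ k, h k * x k - cumGain h i) 0 ∂μ
      ≤ ∫ x, ∑ k : Fin n with i ≤ k.val, h k * x k ∂μ := by
        refine integral_mono_ae (hμ.integrable_max _) (integrable_finsetSum _ fun k _ => hint k) ?_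
        filter_upwards [hμ.peak] with x hx
        exact max_sub_cumGain_le h_pos hx i
    _ = ∑ k : Fin n with i ≤ k.val, h k * ∫ x, x k ∂μ := by
        rw [integral_finsetSum _ fun k _ => hint k]
        simp_rw [integral_const_mul]
    _ ≤ ∑ k : Fin n with i ≤ k.val, h k * α k :=
        Finset.sum_le_sum fun k _ => mul_le_mul_of_nonneg_left (hμ.mean_le k) (h_pos k).le

/-- Since `cumGain h 0 = 0`, the linear term of the exponent is, on `[0, 1 + δ]`, the `i = 0` case
of the hinge terms `l i * max (y - cumGain h i) 0`. -/
theorem dualP_eq_integral_sum (hn : 0 < n) (l : ℕ → ℝ) {δ : ℝ} (hδ : 0 < δ) :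
    dualP h l δ = ∫ y in (0 : ℝ)..(1 + δ),
      Real.exp (-∑ i ∈ Finset.range n, l i * max (y - cumGain h i) 0) := by
  refine intervalIntegral.integral_congr fun y hy => ?_
  rw [uIcc_of_le (by linarith)] at hy
  have h0 : cumGain h 0 = 0 := by simp [cumGain]
  rw [Finset.range_eq_Ico, Finset.sum_eq_sum_Ico_succ_bot hn, h0, sub_zero, max_eq_left hy.1]
  ring_nf

end Gains

/-! ### The bound on the capacity -/

theorem fst_jointLaw {n : ℕ} (h : Fin n → ℝ) (σ : ℝ) (μ : Measure (Fin n → ℝ))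
    [IsProbabilityMeasure μ] : (jointLaw h σ μ).fst = μ := by
  rw [jointLaw, Measure.fst, Measure.map_map measurable_fst (by fun_prop)]
  exact Measure.fst_prod

/-- The duality bound for one feasible input law, with the test density `exp (-testCost)` whose
middle exponent is the sum of all hinge terms. -/
theorem IsFeasibleBC.mutualInfo_jointLaw_le {n : ℕ} {h α : Fin n → ℝ} {σ : ℝ}
    (h_pos : ∀ k, 0 < h k) (h_sum : ∑ k, h k = 1) (hσ : 0 < σ)
    {l : ℕ → ℝ} (hl : ∀ i < n, 0 ≤ l i) {δ : ℝ} (hδ : 0 < δ)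
    {μ : Measure (Fin n → ℝ)} (hμ : IsFeasibleBC α μ) :
    mutualInfo (jointLaw h σ μ) ≤ ENNReal.ofReal
      (Real.log (1 + dualP h l δ / (√(2 * Real.pi * Real.exp 1) * σ))
        + ∑ i ∈ Finset.range n, l i * (1 - cumGain h i) * avgTail h α i
        + ∑ i ∈ Finset.range n, l i * σ / √(2 * Real.pi)
              * (1 - Real.exp (-((1 + δ) ^ 2 / (2 * σ ^ 2))))) := by
  have := hμ.isProbabilityMeasure
  have hn : 0 < n := by
    rcases Nat.eq_zero_or_pos n with rfl | hn
    · simp at h_sum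
    · exact hn
  set v : NNReal := (σ ^ 2).toNNReal
  have hvσ : (v : ℝ) = σ ^ 2 := Real.coe_toNNReal _ (by positivity)
  have hv : v ≠ 0 := by
    intro h0
    rw [h0] at hvσ
    have : 0 < σ ^ 2 := by positivity
    simp at hvσ
    linarith
  set ψ : ℝ → ℝ := fun y => ∑ i ∈ Finset.range n, l i * max (y - cumGain h i) 0
  have hψ : Continuous ψ := by fun_prop
  set P := dualP h l δ
  have hP : P = ∫ y in (0 : ℝ)..(1 + δ), Real.exp (-ψ y) := dualP_eq_integral_sum hn l hδ
  have hP0 : 0 ≤ P := by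
    rw [hP]
    exact intervalIntegral.integral_nonneg (by linarith) fun y _ => (Real.exp_pos _).le
  set K := Real.log (√(2 * Real.pi * v) + Real.exp (-(1 / 2)) * P) with hK_def
  set s : (Fin n → ℝ) → ℝ := fun x => ∑ k, h k * x k
  have hs : Measurable s := by fun_prop
  have hs1 : ∀ᵐ x ∂μ, 0 ≤ s x ∧ s x ≤ 1 + δ := by
    filter_upwards [hμ.peak] with x hx
    refine ⟨Finset.sum_nonneg fun k _ => mul_nonneg (h_pos k).le (hx k).1, ?_⟩
    have : s x ≤ 1 := h_sum ▸
      Finset.sum_le_sum fun k _ => mul_le_of_le_one_right (h_pos k).le (hx k).2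
    linarith
  -- The price of replacing `y = s + z` by `s` in each hinge term.
  set c := v * (gaussianPDFReal 0 v 0 - gaussianPDFReal 0 v (1 + δ)) with hc_def
  have hnorm : ∫⁻ y, ENNReal.ofReal (Real.exp (-testCost v (1 + δ) K ψ y)) = 1 := by
    rw [hK_def, hP]
    exact lintegral_exp_neg_testCost hv (by linarith) hψ
  have hint := integrable_testCost_add (v := v) (1 + δ) K hs hs1 hψ
  have hcost : ∫ p, testCost v (1 + δ) K ψ (s p.1 + p.2) ∂(μ.prod (gaussianReal 0 v)) ≤
      K + 1 / 2 + ∑ i ∈ Finset.range n, l i * ((1 - cumGain h i) * avgTail h α i + c) := by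
    have hmax (i : ℕ) : Integrable (fun x => l i * (max (s x - cumGain h i) 0 + c)) μ :=
      ((hμ.integrable_max _).add (integrable_const c)).const_mul _
    rw [integral_prod _ hint]
    calc ∫ x, ∫ z, testCost v (1 + δ) K ψ (s x + z) ∂(gaussianReal 0 v) ∂μ
        ≤ ∫ x, (K + 1 / 2 + ∑ i ∈ Finset.range n, l i * (max (s x - cumGain h i) 0 + c)) ∂μ := by
          refine integral_mono_ae hint.integral_prod_left
            ((integrable_const _).add (integrable_finsetSum _ fun i _ => hmax i)) ?_
          filter_upwards [hs1] with x hx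
          refine integral_testCost_add_le hv hx.1 hx.2 _ (fun i hi => hl i (Finset.mem_range.mp hi))
            fun i hi => ⟨cumGain_nonneg h_pos i, ?_⟩
          linarith [cumGain_lt_one h_pos h_sum (Finset.mem_range.mp hi)]
      _ = K + 1 / 2 + ∑ i ∈ Finset.range n,
            l i * (∫ x, max (s x - cumGain h i) 0 ∂μ + c) := by
          rw [integral_add (integrable_const _) (integrable_finsetSum _ fun i _ => hmax i),
            integral_finsetSum _ fun i _ => hmax i]
          simp_rw [integral_const_mul]
          simp [integral_add (hμ.integrable_max _) (integrable_const c), s]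
      _ ≤ _ := by
          gcongr with i hi
          · exact hl i (Finset.mem_range.mp hi)
          · exact hμ.integral_max_le h_pos h_sum (Finset.mem_range.mp hi)
  have hsqrt : √(2 * Real.pi * v) = √(2 * Real.pi) * σ := by
    rw [hvσ, Real.sqrt_mul (by positivity), Real.sqrt_sq hσ.le]
  have hexp : √(2 * Real.pi * Real.exp 1) = √(2 * Real.pi) * Real.exp (1 / 2) := by
    rw [Real.sqrt_mul (by positivity), Real.exp_half]
  have hK : K - Real.log (√(2 * Real.pi * v))
      = Real.log (1 + P / (√(2 * Real.pi * Real.exp 1) * σ)) := by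
    have h2 : 0 < √(2 * Real.pi) := by positivity
    rw [hK_def, ← Real.log_div (by positivity) (by positivity), hsqrt, hexp, Real.exp_neg]
    congr 1
    field_simp
  have hc : c = σ / √(2 * Real.pi) * (1 - Real.exp (-((1 + δ) ^ 2 / (2 * σ ^ 2)))) := by
    have h2 : 0 < √(2 * Real.pi) := by positivity
    simp only [hc_def, gaussianPDFReal, hsqrt]
    rw [neg_div, neg_div, hvσ]
    simp only [sub_zero, sub_self, ne_eq, OfNat.ofNat_ne_zero, not_false_eq_true, zero_pow,
      zero_div, neg_zero, Real.exp_zero]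
    field_simp
  calc mutualInfo (jointLaw h σ μ)
      ≤ InformationTheory.klDiv (jointLaw h σ μ) (μ.prod
          (volume.withDensity fun y => ENNReal.ofReal (Real.exp (-testCost v (1 + δ) K ψ y)))) := by
        have : IsProbabilityMeasure (jointLaw h σ μ) :=
          Measure.isProbabilityMeasure_map (by fun_prop)
        have : IsProbabilityMeasure (volume.withDensity fun y =>
            ENNReal.ofReal (Real.exp (-testCost v (1 + δ) K ψ y))) :=
          ⟨by rw [withDensity_apply _ .univ]; simpa using hnorm⟩
        refine (klDiv_fst_prod_snd_le (jointLaw h σ μ) (volume.withDensity fun y =>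
          ENNReal.ofReal (Real.exp (-testCost v (1 + δ) K ψ y)))).trans_eq ?_
        rw [fst_jointLaw]
    _ ≤ ENNReal.ofReal _ :=
        klDiv_additiveGaussian_le μ hs hv (measurable_testCost _ _ _ hψ.measurable) hnorm hint
    _ ≤ _ := by
        refine ENNReal.ofReal_le_ofReal ?_
        rw [← hK, add_assoc, ← Finset.sum_add_distrib]
        refine (sub_le_sub_right hcost _).trans_eq ?_
        rw [hc]
        have : ∀ a b : ℝ, K + 1 / 2 + a - (b + 1 / 2) = K - b + a := by intros; ring
        rw [this]
        congr 1
        refine Finset.sum_congr rfl fun i _ => ?_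
        ring

end OpticalMISO

theorem theorem8 {n : ℕ} (h α : Fin n → ℝ) (σ : ℝ)
    (h_pos : ∀ k, 0 < h k) (h_sum : ∑ k, h k = 1)
    (hα : ∀ k, 0 ≤ α k ∧ α k ≤ 1) (hσ : 0 < σ)
    (l : ℕ → ℝ) (hl : ∀ i < n, 0 ≤ l i) (δ : ℝ) (hδ : 0 < δ) :
    ((OpticalMISO.capacityBC h α σ : ENNReal) : EReal) ≤
      ((Real.log (1 + OpticalMISO.dualP h l δ / (Real.sqrt (2 * Real.pi * Real.exp 1) * σ))
        + ∑ i ∈ Finset.range n,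
            l i * (1 - OpticalMISO.cumGain h i) * OpticalMISO.avgTail h α i
        + ∑ i ∈ Finset.range n,
            l i * σ / Real.sqrt (2 * Real.pi)
              * (1 - Real.exp (-((1 + δ) ^ 2 / (2 * σ ^ 2)))) : ℝ) : EReal) := by
  set B : ℝ := Real.log (1 + OpticalMISO.dualP h l δ / (√(2 * Real.pi * Real.exp 1) * σ))
    + ∑ i ∈ Finset.range n, l i * (1 - OpticalMISO.cumGain h i) * OpticalMISO.avgTail h α i
    + ∑ i ∈ Finset.range n, l i * σ / √(2 * Real.pi)
      * (1 - Real.exp (-((1 + δ) ^ 2 / (2 * σ ^ 2)))) with hB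
  have hB0 : 0 ≤ B := by
    have hP0 : 0 ≤ OpticalMISO.dualP h l δ :=
      intervalIntegral.integral_nonneg (by linarith) fun y _ => (Real.exp_pos _).le
    refine add_nonneg (add_nonneg (Real.log_nonneg ?_) (Finset.sum_nonneg fun i hi => ?_))
      (Finset.sum_nonneg fun i hi => ?_)
    · rw [le_add_iff_nonneg_right]
      positivity
    · have hi' := Finset.mem_range.mp hi
      have hlt := OpticalMISO.cumGain_lt_one h_pos h_sum hi'
      exact mul_nonneg (mul_nonneg (hl i hi') (by linarith))
        (div_nonneg (Finset.sum_nonneg fun k _ => mul_nonneg (h_pos k).le (hα k).1) (by linarith))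
    · have := hl i (Finset.mem_range.mp hi)
      refine mul_nonneg (by positivity) (sub_nonneg.mpr (Real.exp_le_one_iff.mpr ?_))
      exact neg_nonpos.mpr (by positivity)
  -- `B` is nonnegative, so passing through `ENNReal.ofReal B` loses nothing.
  have hcap : OpticalMISO.capacityBC h α σ ≤ ENNReal.ofReal B :=
    iSup₂_le fun μ hμ => hμ.mutualInfo_jointLaw_le h_pos h_sum hσ hl hδ
  rw [← max_eq_left hB0, ← EReal.coe_ennreal_ofReal]
  exact EReal.coe_ennreal_le_coe_ennreal_iff.mpr hcap
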